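/- Let $1\le k\le n$, let $A,B$ be complex $n\times n$ matrices, let $s_1(A)\ge s_2(A)\ge\cdots\ge s_n(A)\ge 0$ be the singular values of $A$, and let $\|A\|_{(k)}=s_1(A)+\cdots+s_k(A)$ be the Ky Fan $k$-norm. Let $A=U|A|$ be a polar decomposition of $A$, where $U$ is an $n\times n$ unitary matrix and $|A|=(A^*A)^{1/2}$. If there exist $k$ orthonormal vectors $u_1,\dots,u_k\in\mathbb C^n$ such that $$|A|\,u_i=s_i(A)\,u_i\quad\text{for all }1\le i\le k$$ and $$\sum_{i=1}^k \operatorname{Re}\,\langle u_i, U^*B\,u_i\rangle=0,$$ then $$\|A+tB\|_{(k)}\ \ge\ \|A\|_{(k)}\quad\text{for all }t\in\mathbb R.$$ If $s_k(A)>0$, then the converse is also true: if $\|A+tB\|_{(k)}\ge\|A\|_{(k)}$ for all $t\in\mathbb R$, then such vectors $u_1,\dots,u_k$ exist. -/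

import Mathlib

open scoped MatrixOrder Matrix

noncomputable section

/-- The singular values of a complex `n × n` matrix, in decreasing order and counted with
multiplicity. The index starts at `0`: the value `s_i(A)` of the usual enumeration
`s_1(A) ≥ ⋯ ≥ s_n(A)` is `singularValue A (i - 1)`. -/
def singularValue {n : ℕ} (A : Matrix (Fin n) (Fin n) ℂ) (i : ℕ) : ℝ :=
  (Matrix.toEuclideanLin A).singularValues i

/-- The Ky Fan `k`-norm: the sum of the `k` largest singular values. -/
def kyFanNorm {n : ℕ} (k : ℕ) (A : Matrix (Fin n) (Fin n) ℂ) : ℝ :=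
  ∑ i ∈ Finset.range k, singularValue A i

/-- `A = U |A|` is a polar decomposition of the square matrix `A`: the factor `U` is unitary, and
`|A|` is the positive semidefinite square root of `Aᴴ * A`. -/
def IsPolarDecomposition {n : ℕ} (A U : Matrix (Fin n) (Fin n) ℂ) : Prop :=
  U ∈ Matrix.unitaryGroup (Fin n) ℂ ∧ A = U * CFC.abs A

/-- There are `k` orthonormal vectors `u_1, …, u_k` with `|A| u_i = s_i(A) u_i` for all `i` and
`∑ i, Re ⟪u_i, Uᴴ B u_i⟫ = 0`. The inner product is conjugate linear in its first argument. -/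
def HasRealOrthogonalEigenvectors {n : ℕ} (k : ℕ) (A U B : Matrix (Fin n) (Fin n) ℂ) : Prop :=
  ∃ u : Fin k → EuclideanSpace ℂ (Fin n), Orthonormal ℂ u ∧
    (∀ i : Fin k,
      Matrix.toEuclideanLin (CFC.abs A) (u i) = (singularValue A (i : ℕ) : ℂ) • u i) ∧
    ∑ i : Fin k, (inner ℂ (u i) (Matrix.toEuclideanLin (Uᴴ * B) (u i))).re = 0

end

/-! By Ky Fan's inequality, `‖T‖_(k)` is the maximum of `∑ Re ⟪y_i, T x_i⟫` over orthonormal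
`k`-tuples `x`, `y`. Testing `A + tB` on `x = u`, `y = U u` gives `‖A‖_(k) + t · 0`, which is the
direct implication. For the converse, singular value decompositions of `A + tB` with `t → 0⁺` have,
by compactness, a limit point: a decomposition `e, g` of `A` with `∑ Re ⟪g_i, B e_i⟫ ≥ 0`. As `s_i >
0` for `i ≤ k`, `g_i = U e_i`. Replacing `B` by `-B` gives a second eigenbasis `e'` of `A*A` with
the opposite sign. The two are joined by a path of unitaries commuting with `A*A`, and the
intermediate value theorem gives a zero on the path. -/

/-! ### Ky Fan's inequality and singular value decompositions -/

section KyFan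

variable {E : Type*} [NormedAddCommGroup E] [InnerProductSpace ℂ E]

/-- A threshold `c` separates the first `k` values from the rest. The sum of `(r j - c) * w j` is
largest when `w` is the indicator of the first `k` indices, and the remaining `c * ∑ w` is at most
`c * k`. -/
theorem Antitone.sum_mul_le_sum_castLE {n k : ℕ} (hkn : k ≤ n) {r w : Fin n → ℝ}
    (hr : Antitone r) (hr0 : ∀ j, 0 ≤ r j) (hw0 : ∀ j, 0 ≤ w j) (hw1 : ∀ j, w j ≤ 1)
    (hw : ∑ j, w j ≤ k) :
    ∑ j, r j * w j ≤ ∑ i : Fin k, r (Fin.castLE hkn i) := by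
  obtain ⟨d, rfl⟩ := Nat.exists_eq_add_of_le hkn
  obtain ⟨c, hc0, hc1, hc2⟩ : ∃ c : ℝ, 0 ≤ c ∧ (∀ i : Fin k, c ≤ r (Fin.castAdd d i)) ∧
      ∀ i : Fin d, r (Fin.natAdd k i) ≤ c := by
    rcases Nat.eq_zero_or_pos k with rfl | hk
    · exact ⟨∑ j, r j, Finset.sum_nonneg fun j _ => hr0 j, fun i => i.elim0,
        fun i => Finset.single_le_sum (fun j _ => hr0 j) (Finset.mem_univ _)⟩
    · refine ⟨r ⟨k - 1, by omega⟩, hr0 _, fun i => hr ?_, fun i => hr ?_⟩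
      · rw [Fin.le_def]
        simp only [Fin.val_castAdd]
        omega
      · rw [Fin.le_def]
        simp only [Fin.val_natAdd]
        omega
  have h1 : ∑ j, (r j - c) * w j ≤ ∑ i : Fin k, (r (Fin.castAdd d i) - c) := by
    rw [Fin.sum_univ_add]
    have ha : ∑ i : Fin k, (r (Fin.castAdd d i) - c) * w (Fin.castAdd d i) ≤
        ∑ i : Fin k, (r (Fin.castAdd d i) - c) :=
      Finset.sum_le_sum fun i _ => mul_le_of_le_one_right (sub_nonneg.2 (hc1 i)) (hw1 _)
    have hb : ∑ i : Fin d, (r (Fin.natAdd k i) - c) * w (Fin.natAdd k i) ≤ 0 :=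
      Finset.sum_nonpos fun i _ => mul_nonpos_of_nonpos_of_nonneg (sub_nonpos.2 (hc2 i)) (hw0 _)
    linarith
  have h2 : c * ∑ j, w j ≤ c * k := mul_le_mul_of_nonneg_left hw hc0
  simp only [sub_mul, Finset.sum_sub_distrib, ← Finset.mul_sum, Finset.sum_const,
    Finset.card_univ, Fintype.card_fin, nsmul_eq_mul] at h1
  have h3 : ∑ i : Fin k, r (Fin.castLE hkn i) = ∑ i : Fin k, r (Fin.castAdd d i) := rfl
  linarith

/-- **Ky Fan's inequality**, for an operator with a given singular value decomposition. -/
theorem sum_re_inner_le_sum_of_svd {n k : ℕ} (hkn : k ≤ n) {T : E →ₗ[ℂ] E}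
    (e g : OrthonormalBasis (Fin n) ℂ E) {r : Fin n → ℝ} (hr : Antitone r) (hr0 : ∀ j, 0 ≤ r j)
    (hT : ∀ j, T (e j) = (r j : ℂ) • g j) {x y : Fin k → E} (hx : Orthonormal ℂ x)
    (hy : Orthonormal ℂ y) :
    ∑ i, (inner ℂ (y i) (T (x i))).re ≤ ∑ i : Fin k, r (Fin.castLE hkn i) := by
  -- Expand in the two bases and bound each product of coefficients by the mean of their squares.
  -- The resulting weights are at most 1 by Bessel and have total `k` by Parseval.
  have key (i : Fin k) : (inner ℂ (y i) (T (x i))).re ≤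
      ∑ j, r j * ((‖inner ℂ (y i) (g j)‖ ^ 2 + ‖inner ℂ (x i) (e j)‖ ^ 2) / 2) := by
    have hexp : inner ℂ (y i) (T (x i)) =
        ∑ j, (r j : ℂ) * (inner ℂ (y i) (g j) * inner ℂ (e j) (x i)) := by
      conv_lhs => rw [← e.sum_repr' (x i)]
      simp only [map_sum, map_smul, hT, inner_sum, inner_smul_right]
      exact Finset.sum_congr rfl fun j _ => by ring
    rw [hexp, Complex.re_sum]
    refine Finset.sum_le_sum fun j _ => ?_
    rw [Complex.re_ofReal_mul]
    refine mul_le_mul_of_nonneg_left ?_ (hr0 j)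
    refine (Complex.re_le_norm _).trans ?_
    rw [norm_mul, norm_inner_symm (e j)]
    nlinarith [sq_nonneg (‖inner ℂ (y i) (g j)‖ - ‖inner ℂ (x i) (e j)‖)]
  refine (Finset.sum_le_sum fun i _ => key i).trans ?_
  rw [Finset.sum_comm]
  simp_rw [← Finset.mul_sum]
  have bessel {v : Fin k → E} (hv : Orthonormal ℂ v) (b : OrthonormalBasis (Fin n) ℂ E)
      (j : Fin n) : ∑ i, ‖inner ℂ (v i) (b j)‖ ^ 2 ≤ 1 := by
    simpa using hv.sum_inner_products_le (b j) (s := Finset.univ)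
  have total {v : Fin k → E} (hv : Orthonormal ℂ v) (b : OrthonormalBasis (Fin n) ℂ E) :
      ∑ j, ∑ i, ‖inner ℂ (v i) (b j)‖ ^ 2 = k := by
    rw [Finset.sum_comm]
    simp [b.sum_sq_norm_inner_left, hv.1]
  refine hr.sum_mul_le_sum_castLE hkn hr0 (fun j => by positivity) (fun j => ?_) ?_
  · rw [← Finset.sum_div, Finset.sum_add_distrib]
    linarith [bessel hy g j, bessel hx e j]
  · simp_rw [← Finset.sum_div, Finset.sum_add_distrib]
    rw [total hy, total hx]
    simp

/-- Existence of a singular value decomposition. -/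
theorem LinearMap.exists_svd [FiniteDimensional ℂ E] {n : ℕ} (hn : Module.finrank ℂ E = n)
    (T : E →ₗ[ℂ] E) :
    ∃ e g : OrthonormalBasis (Fin n) ℂ E, ∀ j : Fin n,
      T (e j) = (T.singularValues j : ℂ) • g j := by
  set hS := T.isSymmetric_adjoint_comp_self
  set e := hS.eigenvectorBasis hn
  have hinner (i j : Fin n) :
      inner ℂ (T (e i)) (T (e j)) = if i = j then (T.singularValues i : ℂ) ^ 2 else 0 := by
    rw [← LinearMap.adjoint_inner_right, ← LinearMap.comp_apply,
      hS.apply_eigenvectorBasis hn j, inner_smul_right,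
      orthonormal_iff_ite.1 e.orthonormal]
    split_ifs with h
    · subst h
      rw [← T.sq_singularValues_fin hn]
      simp
    · simp
  -- The vectors `T e_j / s_j` with `s_j ≠ 0` are orthonormal. Where `s_j = 0`, `T e_j = 0`, so any
  -- completion serves.
  obtain ⟨g, hg⟩ := Orthonormal.exists_orthonormalBasis_extension_of_card_eq
    (𝕜 := ℂ) (E := E) (ι := Fin n) (by simpa using hn)
    (v := fun j => ((T.singularValues j : ℂ))⁻¹ • T (e j))
    (s := {j | T.singularValues j ≠ 0}) (by
      rw [orthonormal_iff_ite]
      rintro ⟨i, hi⟩ ⟨j, hj⟩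
      have hi' : (T.singularValues i : ℂ) ≠ 0 := by exact_mod_cast hi
      simp only [Set.domRestrict_apply, inner_smul_left, inner_smul_right, hinner,
        Subtype.mk.injEq]
      split_ifs with h
      · subst h
        simp only [map_inv₀, Complex.conj_ofReal]
        field_simp
      · simp)
  refine ⟨e, g, fun j => ?_⟩
  by_cases hj : T.singularValues j = 0
  · have := hinner j j
    simp only [hj, if_true] at this
    simpa [hj] using this
  · have hj' : (T.singularValues j : ℂ) ≠ 0 := by exact_mod_cast hj
    rw [hg j hj, smul_inv_smul₀ hj']

theorem LinearMap.sum_re_inner_le_sum_singularValues [FiniteDimensional ℂ E] {n k : ℕ}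
    (hn : Module.finrank ℂ E = n) (hkn : k ≤ n) (T : E →ₗ[ℂ] E) {x y : Fin k → E}
    (hx : Orthonormal ℂ x) (hy : Orthonormal ℂ y) :
    ∑ i, (inner ℂ (y i) (T (x i))).re ≤ ∑ i : Fin k, T.singularValues i := by
  obtain ⟨e, g, h⟩ := T.exists_svd hn
  exact sum_re_inner_le_sum_of_svd hkn e g
    (fun i j hij => T.singularValues_antitone hij)
    (fun j => T.singularValues_nonneg j) h hx hy

theorem re_inner_svd {n : ℕ} {T : E →ₗ[ℂ] E} {e g : OrthonormalBasis (Fin n) ℂ E} {r : Fin n → ℝ}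
    (hT : ∀ j, T (e j) = (r j : ℂ) • g j) (j : Fin n) :
    (inner ℂ (g j) (T (e j))).re = r j := by
  simp [hT]

/-- The singular values are determined by any ordered singular value decomposition. -/
theorem LinearMap.singularValues_eq_of_svd [FiniteDimensional ℂ E] {n : ℕ} {T : E →ₗ[ℂ] E}
    (e g : OrthonormalBasis (Fin n) ℂ E) {r : Fin n → ℝ} (hr : Antitone r) (hr0 : ∀ j, 0 ≤ r j)
    (hT : ∀ j, T (e j) = (r j : ℂ) • g j) (j : Fin n) : T.singularValues j = r j := by
  have hn : Module.finrank ℂ E = n := by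
    rw [Module.finrank_eq_card_basis e.toBasis, Fintype.card_fin]
  obtain ⟨e', g', h'⟩ := T.exists_svd hn
  -- Each decomposition attains the maximum in Ky Fan's inequality, so all partial sums agree; their
  -- differences give the values.
  have hsum (m : ℕ) (hm : m ≤ n) :
      ∑ i : Fin m, T.singularValues i = ∑ i : Fin m, r (Fin.castLE hm i) := by
    apply le_antisymm
    · have := sum_re_inner_le_sum_of_svd hm e g hr hr0 hT
        (e'.orthonormal.comp _ (Fin.castLE_injective hm))
        (g'.orthonormal.comp _ (Fin.castLE_injective hm))
      simpa [re_inner_svd (r := fun j => T.singularValues j) h'] using this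
    · have := T.sum_re_inner_le_sum_singularValues hn hm
        (e.orthonormal.comp _ (Fin.castLE_injective hm))
        (g.orthonormal.comp _ (Fin.castLE_injective hm))
      simpa [re_inner_svd hT] using this
  have h0 := hsum j j.2.le
  have h1 := hsum (j + 1) j.2
  rw [Fin.sum_univ_castSucc, Fin.sum_univ_castSucc] at h1
  have h2 : ∑ i : Fin j, r (Fin.castLE j.2 i.castSucc) = ∑ i : Fin j, r (Fin.castLE j.2.le i) := rfl
  have h3 : r (Fin.castLE j.2 (Fin.last j)) = r j := rfl
  simp only [Fin.val_castSucc, Fin.val_last] at h1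
  linarith

end KyFan

/-! ### Limits of singular value decompositions -/

section Limit

open Filter Topology

variable {E : Type*} [NormedAddCommGroup E] [InnerProductSpace ℂ E]

theorem isCompact_setOf_orthonormal [FiniteDimensional ℂ E] (ι : Type*) [Fintype ι] :
    IsCompact {v : ι → E | Orthonormal ℂ v} := by
  classical
  have := FiniteDimensional.proper ℂ E
  refine Metric.isCompact_of_isClosed_isBounded ?_ ?_
  · simp only [orthonormal_iff_ite, Set.ofPred_forall]
    exact isClosed_iInter fun i => isClosed_iInter fun j =>
      isClosed_eq (by fun_prop) continuous_const
  · refine (Metric.isBounded_closedBall (x := (0 : ι → E)) (r := 1)).subset fun v hv => ?_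
    rw [mem_closedBall_zero_iff, pi_norm_le_iff_of_nonneg zero_le_one]
    exact fun i => (hv.1 i).le

theorem Orthonormal.exists_orthonormalBasis_eq [FiniteDimensional ℂ E] {n : ℕ}
    (hn : Module.finrank ℂ E = n) {v : Fin n → E} (hv : Orthonormal ℂ v) :
    ∃ b : OrthonormalBasis (Fin n) ℂ E, ∀ j, b j = v j := by
  obtain ⟨b, hb⟩ := Orthonormal.exists_orthonormalBasis_extension_of_card_eq
    (𝕜 := ℂ) (E := E) (ι := Fin n) (by simpa using hn) (v := v) (s := Set.univ)
    (hv.comp _ Subtype.val_injective)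
  exact ⟨b, fun j => hb j (Set.mem_univ j)⟩

/-- If the Ky Fan norm does not decrease along the ray from `T` in the direction `S`, then some
singular value decomposition of `T` witnesses that the directional derivative is nonnegative. -/
theorem LinearMap.exists_svd_nonneg_of_sum_singularValues_le [FiniteDimensional ℂ E] {n k : ℕ}
    (hn : Module.finrank ℂ E = n) (hkn : k ≤ n) (T S : E →ₗ[ℂ] E)
    (h : ∀ t : ℝ, 0 < t →
      ∑ i : Fin k, T.singularValues i ≤ ∑ i : Fin k, (T + (t : ℂ) • S).singularValues i) :
    ∃ e g : OrthonormalBasis (Fin n) ℂ E,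
      (∀ j : Fin n, T (e j) = (T.singularValues j : ℂ) • g j) ∧
      0 ≤ ∑ i : Fin k, (inner ℂ (g (Fin.castLE hkn i)) (S (e (Fin.castLE hkn i)))).re := by
  let t : ℕ → ℝ := fun m => 1 / ((m : ℝ) + 1)
  have ht : Tendsto t atTop (𝓝 0) := tendsto_one_div_add_atTop_nhds_zero_nat
  have htpos (m : ℕ) : 0 < t m := Nat.one_div_pos_of_nat
  choose e g hsvd using fun m => (T + (t m : ℂ) • S).exists_svd hn
  obtain ⟨⟨e₀, g₀⟩, ⟨he₀, hg₀⟩, φ, hφ, hlim⟩ :=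
    ((isCompact_setOf_orthonormal (E := E) (Fin n)).prod
      (isCompact_setOf_orthonormal (E := E) (Fin n))).tendsto_subseq
      (x := fun m => ((e m : Fin n → E), (g m : Fin n → E)))
      (fun m => ⟨(e m).orthonormal, (g m).orthonormal⟩)
  have hTc := T.continuous_of_finiteDimensional
  have hSc := S.continuous_of_finiteDimensional
  have hlime (j : Fin n) : Tendsto (fun m => e (φ m) j) atTop (𝓝 (e₀ j)) :=
    ((continuous_apply j).comp continuous_fst).tendsto (e₀, g₀) |>.comp hlim
  have hlimg (j : Fin n) : Tendsto (fun m => g (φ m) j) atTop (𝓝 (g₀ j)) :=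
    ((continuous_apply j).comp continuous_snd).tendsto (e₀, g₀) |>.comp hlim
  have hlimT (j : Fin n) : Tendsto (fun m => (T + (t (φ m) : ℂ) • S) (e (φ m) j)) atTop
      (𝓝 (T (e₀ j))) := by
    have h1 := ((hTc.tendsto _).comp (hlime j)).add
      ((((Complex.continuous_ofReal.tendsto _).comp (ht.comp hφ.tendsto_atTop))).smul
        ((hSc.tendsto _).comp (hlime j)))
    simpa [Function.comp_def] using h1
  -- Convergence of the singular values comes from that of the vectors, since `s_j = Re ⟪g_j, T
  -- e_j⟫`.
  have hlimr (j : Fin n) : Tendsto (fun m => (T + (t (φ m) : ℂ) • S).singularValues j) atTop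
      (𝓝 (inner ℂ (g₀ j) (T (e₀ j))).re) := by
    have h1 := (Complex.continuous_re.tendsto _).comp ((hlimg j).inner (𝕜 := ℂ) (hlimT j))
    refine h1.congr fun m => ?_
    exact re_inner_svd (r := fun j => (T + (t (φ m) : ℂ) • S).singularValues j) (hsvd (φ m)) j
  obtain ⟨e', he'⟩ := he₀.exists_orthonormalBasis_eq hn
  obtain ⟨g', hg'⟩ := hg₀.exists_orthonormalBasis_eq hn
  have hsvd₀ (j : Fin n) : T (e' j) = (((inner ℂ (g₀ j) (T (e₀ j))).re : ℝ) : ℂ) • g' j := by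
    rw [he', hg']
    refine tendsto_nhds_unique (hlimT j) ?_
    refine (((Complex.continuous_ofReal.tendsto _).comp (hlimr j)).smul (hlimg j)).congr
      fun m => ?_
    exact (hsvd (φ m) j).symm
  have hsv := LinearMap.singularValues_eq_of_svd e' g'
    (fun i j hij => le_of_tendsto_of_tendsto' (hlimr j) (hlimr i)
      fun m => LinearMap.singularValues_antitone _ hij)
    (fun j => ge_of_tendsto' (hlimr j) fun m => LinearMap.singularValues_nonneg _ _) hsvd₀
  refine ⟨e', g', fun j => by rw [hsv, hsvd₀], ?_⟩
  simp only [he', hg']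
  refine ge_of_tendsto' (tendsto_finsetSum _ fun i _ => (Complex.continuous_re.tendsto _).comp
    ((hlimg (Fin.castLE hkn i)).inner (𝕜 := ℂ) ((hSc.tendsto _).comp (hlime _)))) fun m => ?_
  have h1 := h _ (htpos (φ m))
  have h2 : ∑ i : Fin k, (T + (t (φ m) : ℂ) • S).singularValues i =
      ∑ i : Fin k, (inner ℂ (g (φ m) (Fin.castLE hkn i)) (T (e (φ m) (Fin.castLE hkn i)))).re +
      t (φ m) * ∑ i : Fin k,
        (inner ℂ (g (φ m) (Fin.castLE hkn i)) (S (e (φ m) (Fin.castLE hkn i)))).re := by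
    rw [Finset.mul_sum, ← Finset.sum_add_distrib]
    refine Finset.sum_congr rfl fun i _ => ?_
    have := re_inner_svd (r := fun j => (T + (t (φ m) : ℂ) • S).singularValues j) (hsvd (φ m))
      (Fin.castLE hkn i)
    simp only [Fin.val_castLE] at this
    rw [← this, LinearMap.add_apply, LinearMap.smul_apply, inner_add_right, inner_smul_right,
      Complex.add_re, Complex.re_ofReal_mul]
  -- The `T`-part is at most the Ky Fan norm of `T`, hence at most that of `T + tS`; the `S`-part
  -- must make up the difference.
  have h3 := T.sum_re_inner_le_sum_singularValues hn hkn
    ((e (φ m)).orthonormal.comp _ (Fin.castLE_injective hkn))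
    ((g (φ m)).orthonormal.comp _ (Fin.castLE_injective hkn))
  simp only [Function.comp_apply] at h3 ⊢
  refine nonneg_of_mul_nonneg_right (a := t (φ m)) ?_ (htpos _)
  linarith

end Limit

/-! ### Paths of unitaries in a commutant -/

section Path

open selfAdjoint in
-- Any function is continuous on a finite spectrum, so the branch cut of `arg` at `-1` does no harm.
theorem Unitary.expUnitary_argSelfAdjoint_of_finite_spectrum {A : Type*} [CStarAlgebra A]
    {u : unitary A} (hu : (spectrum ℂ (u : A)).Finite) :
    expUnitary (argSelfAdjoint u) = u := by
  ext
  have : ContinuousOn Complex.arg (spectrum ℂ (u : A)) := hu.continuousOn _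
  rw [expUnitary_coe, argSelfAdjoint_coe, ← CFC.exp_eq_normedSpace_exp (𝕜 := ℂ),
    ← cfc_comp_smul .., ← cfc_comp' ..]
  conv_rhs => rw [← cfc_id' ℂ (u : A)]
  refine cfc_congr fun y hy ↦ ?_
  have hy₁ : ‖y‖ = 1 := spectrum.norm_eq_one_of_unitary u.2 hy
  have : Complex.I * y.arg = Complex.log y :=
    Complex.ext (by simp [Complex.log_re, hy₁]) (by simp [Complex.log_im])
  simpa [← Complex.exp_eq_exp_ℂ, this] using Complex.exp_log (by aesop)

theorem Unitary.commute_star_of_commute {A : Type*} [Monoid A] [StarMul A] {u : unitary A}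
    {a : A} (h : Commute (u : A) a) : Commute (star (u : A)) a := by
  have h1 := Unitary.star_mul_self u
  have h2 := Unitary.mul_star_self u
  calc star (u : A) * a = star (u : A) * a * ((u : A) * star (u : A)) := by simp
    _ = star (u : A) * (a * (u : A)) * star (u : A) := by simp only [mul_assoc]
    _ = (star (u : A) * (u : A)) * a * star (u : A) := by rw [← h.eq]; simp only [mul_assoc]
    _ = a * star (u : A) := by simp

/-- A unitary with finite spectrum is joined to `1` by a path of unitaries commuting with everything
it commutes with. -/
theorem Unitary.exists_path_commute {A : Type*} [CStarAlgebra A] {u : unitary A}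
    (hu : (spectrum ℂ (u : A)).Finite) {a : A} (h : Commute (u : A) a) :
    ∃ W : ℝ → unitary A, Continuous W ∧ W 0 = 1 ∧ W 1 = u ∧ ∀ t, Commute (W t : A) a := by
  -- The path is `exp(i t arg u)`.
  refine ⟨fun t => selfAdjoint.expUnitary (t • Unitary.argSelfAdjoint u), by fun_prop, by simp,
    ?_, fun t => ?_⟩
  · simp only [one_smul]
    exact Unitary.expUnitary_argSelfAdjoint_of_finite_spectrum hu
  · have hK : Commute (Unitary.argSelfAdjoint u : A) a :=
      h.cfc (Unitary.commute_star_of_commute h) _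
    rw [selfAdjoint.expUnitary_coe]
    let +nondep : NormedAlgebra ℚ A := .restrictScalars ℚ ℂ A
    refine Commute.exp_left (Commute.smul_left ?_ _)
    exact hK.smul_left t

variable {E : Type*} [NormedAddCommGroup E] [InnerProductSpace ℂ E]

/-- Two orthonormal eigenbases of `Q` with the same eigenvalues are joined by a path of unitaries
commuting with `Q`. -/
theorem exists_unitary_path_of_eigenbases [FiniteDimensional ℂ E] [CompleteSpace E]
    {ι : Type*} [Fintype ι]
    (e e' : OrthonormalBasis ι ℂ E) (Q : E →L[ℂ] E) {c : ι → ℂ} (he : ∀ j, Q (e j) = c j • e j)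
    (he' : ∀ j, Q (e' j) = c j • e' j) :
    ∃ W : ℝ → unitary (E →L[ℂ] E), Continuous W ∧ W 0 = 1 ∧
      (∀ j, (W 1 : E →L[ℂ] E) (e j) = e' j) ∧ ∀ t, Commute (W t : E →L[ℂ] E) Q := by
  set V : unitary (E →L[ℂ] E) := Unitary.linearIsometryEquiv.symm (e.equiv e' (Equiv.refl ι))
  have hV (j : ι) : (V : E →L[ℂ] E) (e j) = e' j := e.equiv_apply_basis e' (Equiv.refl ι) j
  have hcomm : Commute (V : E →L[ℂ] E) Q := by
    refine ContinuousLinearMap.coe_injective (e.toBasis.ext fun j => ?_)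
    simp [hV, he, he']
  have hfin : (spectrum ℂ (V : E →L[ℂ] E)).Finite := by
    have h := Module.End.finite_spectrum ((Module.End.toContinuousLinearMap E).symm (V : E →L[ℂ] E))
    rwa [AlgEquiv.spectrum_eq] at h
  obtain ⟨W, hW, hW0, hW1, hWQ⟩ := Unitary.exists_path_commute hfin hcomm
  exact ⟨W, hW, hW0, fun j => by rw [hW1, hV], hWQ⟩

end Path

/-! ### Singular vectors as eigenvectors -/

section SingularVectors

variable {E : Type*} [NormedAddCommGroup E] [InnerProductSpace ℂ E]

/-- The vector `y = P x - s x` satisfies `P y = -s y`, and positivity of `P` with `s > 0` forces `y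
= 0`. -/
theorem LinearMap.IsPositive.apply_eq_smul_of_comp_self {P : E →ₗ[ℂ] E} (hP : P.IsPositive)
    {s : ℝ} (hs : 0 < s) {x : E} (hx : P (P x) = ((s ^ 2 : ℝ) : ℂ) • x) : P x = (s : ℂ) • x := by
  have hy : P (P x - (s : ℂ) • x) = -((s : ℂ) • (P x - (s : ℂ) • x)) := by
    rw [map_sub, map_smul, hx, smul_sub, smul_smul]
    push_cast
    rw [sq]
    abel
  have h := hP.re_inner_nonneg_right (P x - (s : ℂ) • x)
  rw [hy, inner_neg_right, inner_smul_right, inner_self_eq_norm_sq_to_K] at h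
  have h' : 0 ≤ -(s * ‖P x - (s : ℂ) • x‖ ^ 2) := by
    simpa [← Complex.ofReal_pow, ← Complex.ofReal_mul] using h
  have h0 : ‖P x - (s : ℂ) • x‖ ^ 2 = 0 := by
    nlinarith [sq_nonneg ‖P x - (s : ℂ) • x‖]
  exact sub_eq_zero.1 (norm_eq_zero.1 (pow_eq_zero_iff two_ne_zero |>.1 h0))

theorem LinearMap.adjoint_apply_of_svd [FiniteDimensional ℂ E] {ι : Type*} [Fintype ι]
    {T : E →ₗ[ℂ] E}
    {e g : OrthonormalBasis ι ℂ E} {r : ι → ℝ} (hT : ∀ j, T (e j) = (r j : ℂ) • g j) (j : ι) :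
    LinearMap.adjoint T (g j) = (r j : ℂ) • e j := by
  classical
  refine InnerProductSpace.ext_inner_left_basis e.toBasis fun i => ?_
  rw [e.coe_toBasis, LinearMap.adjoint_inner_right, hT, inner_smul_left, inner_smul_right,
    orthonormal_iff_ite.1 g.orthonormal, orthonormal_iff_ite.1 e.orthonormal]
  split_ifs with h
  · simp [h]
  · simp

theorem LinearMap.adjoint_comp_self_apply_of_svd [FiniteDimensional ℂ E] {ι : Type*} [Fintype ι]
    {T : E →ₗ[ℂ] E}
    {e g : OrthonormalBasis ι ℂ E} {r : ι → ℝ} (hT : ∀ j, T (e j) = (r j : ℂ) • g j) (j : ι) :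
    (LinearMap.adjoint T ∘ₗ T) (e j) = ((r j ^ 2 : ℝ) : ℂ) • e j := by
  rw [LinearMap.comp_apply, hT, map_smul, adjoint_apply_of_svd hT, smul_smul]
  push_cast
  rw [sq]

end SingularVectors

/-! ### Polar decomposition and the two implications -/

section Polar

variable {n : ℕ} {A B U : Matrix (Fin n) (Fin n) ℂ}

theorem kyFanNorm_eq_sum_fin (k : ℕ) (A : Matrix (Fin n) (Fin n) ℂ) :
    kyFanNorm k A = ∑ i : Fin k, (Matrix.toEuclideanLin A).singularValues i :=
  Finset.sum_range _

theorem CFC.isPositive_toEuclideanLin_abs (A : Matrix (Fin n) (Fin n) ℂ) :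
    (Matrix.toEuclideanLin (CFC.abs A)).IsPositive :=
  Matrix.isPositive_toEuclideanLin_iff.2 (Matrix.nonneg_iff_posSemidef.1 (CFC.abs_nonneg A))

theorem CFC.toEuclideanLin_abs_apply_abs (A : Matrix (Fin n) (Fin n) ℂ)
    (x : EuclideanSpace ℂ (Fin n)) :
    Matrix.toEuclideanLin (CFC.abs A) (Matrix.toEuclideanLin (CFC.abs A) x) =
      (LinearMap.adjoint (Matrix.toEuclideanLin A) ∘ₗ Matrix.toEuclideanLin A) x := by
  rw [← Matrix.toEuclideanLin_conjTranspose_eq_adjoint, ← Matrix.toLpLin_mul_same,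
    ← Matrix.star_eq_conjTranspose, ← CFC.abs_mul_abs, Matrix.toLpLin_mul_same,
    LinearMap.comp_apply]

theorem IsPolarDecomposition.toEuclideanLin_apply (hU : IsPolarDecomposition A U)
    (x : EuclideanSpace ℂ (Fin n)) :
    Matrix.toEuclideanLin A x =
      Matrix.toEuclideanLin U (Matrix.toEuclideanLin (CFC.abs A) x) := by
  conv_lhs => rw [hU.2]
  rw [Matrix.toLpLin_mul_same, LinearMap.comp_apply]

theorem inner_toEuclideanLin_conjTranspose_mul (U B : Matrix (Fin n) (Fin n) ℂ)
    (x y : EuclideanSpace ℂ (Fin n)) :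
    inner ℂ x (Matrix.toEuclideanLin (Uᴴ * B) y) =
      inner ℂ (Matrix.toEuclideanLin U x) (Matrix.toEuclideanLin B y) := by
  rw [Matrix.toLpLin_mul_same, LinearMap.comp_apply,
    Matrix.toEuclideanLin_conjTranspose_eq_adjoint, LinearMap.adjoint_inner_right]

theorem inner_toEuclideanLin_of_mem_unitaryGroup (hU : U ∈ Matrix.unitaryGroup (Fin n) ℂ)
    (x y : EuclideanSpace ℂ (Fin n)) :
    inner ℂ (Matrix.toEuclideanLin U x) (Matrix.toEuclideanLin U y) = inner ℂ x y := by
  rw [← inner_toEuclideanLin_conjTranspose_mul, ← Matrix.star_eq_conjTranspose,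
    Unitary.star_mul_self_of_mem hU, Matrix.toLpLin_one, LinearMap.id_apply]

/-- Here `|A| e_j = r_j e_j`, so `r_j U e_j = r_j g_j`, and `r_j > 0` cancels. -/
theorem IsPolarDecomposition.apply_eq_of_svd (hU : IsPolarDecomposition A U)
    {e g : OrthonormalBasis (Fin n) ℂ (EuclideanSpace ℂ (Fin n))} {r : Fin n → ℝ}
    (hA : ∀ j, Matrix.toEuclideanLin A (e j) = (r j : ℂ) • g j) {j : Fin n} (hj : 0 < r j) :
    Matrix.toEuclideanLin U (e j) = g j := by
  have h := (CFC.isPositive_toEuclideanLin_abs A).apply_eq_smul_of_comp_self hj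
    ((CFC.toEuclideanLin_abs_apply_abs A _).trans (LinearMap.adjoint_comp_self_apply_of_svd hA j))
  have h1 := hA j
  rw [hU.toEuclideanLin_apply, h, map_smul] at h1
  exact smul_right_injective _ (Complex.ofReal_ne_zero.2 hj.ne') h1

theorem HasRealOrthogonalEigenvectors.kyFanNorm_le {k : ℕ} (hkn : k ≤ n)
    (hU : IsPolarDecomposition A U) (h : HasRealOrthogonalEigenvectors k A U B) (t : ℝ) :
    kyFanNorm k A ≤ kyFanNorm k (A + (t : ℂ) • B) := by
  obtain ⟨u, hu, hAu, hB⟩ := h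
  have hUu : Orthonormal ℂ fun i => Matrix.toEuclideanLin U (u i) := by
    rw [orthonormal_iff_ite] at hu ⊢
    intro i j
    rw [inner_toEuclideanLin_of_mem_unitaryGroup hU.1, hu]
  have key := (Matrix.toEuclideanLin (A + (t : ℂ) • B)).sum_re_inner_le_sum_singularValues
    finrank_euclideanSpace_fin hkn hu hUu
  rw [kyFanNorm_eq_sum_fin, kyFanNorm_eq_sum_fin]
  refine le_trans (le_of_eq ?_) key
  have hterm (i : Fin k) : (inner ℂ (Matrix.toEuclideanLin U (u i))
      (Matrix.toEuclideanLin (A + (t : ℂ) • B) (u i))).re = singularValue A i +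
        t * (inner ℂ (u i) (Matrix.toEuclideanLin (Uᴴ * B) (u i))).re := by
    rw [map_add, map_smul, LinearMap.add_apply, LinearMap.smul_apply, inner_add_right,
      inner_smul_right, hU.toEuclideanLin_apply, inner_toEuclideanLin_of_mem_unitaryGroup hU.1,
      hAu, inner_toEuclideanLin_conjTranspose_mul, inner_smul_right, inner_self_eq_norm_sq_to_K,
      hu.1, Complex.add_re, Complex.re_ofReal_mul]
    simp
  simp_rw [hterm, Finset.sum_add_distrib, ← Finset.mul_sum, hB, mul_zero, add_zero]
  rfl

/-- A singular value decomposition of `A` with nonnegative directional derivative along `B`, in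
terms of the polar decomposition. -/
theorem IsPolarDecomposition.exists_eigenbasis_nonneg {k : ℕ} (hkn : k ≤ n)
    (hU : IsPolarDecomposition A U) (hpos : ∀ i < k, 0 < singularValue A i)
    (h : ∀ t : ℝ, kyFanNorm k A ≤ kyFanNorm k (A + (t : ℂ) • B)) :
    ∃ e : OrthonormalBasis (Fin n) ℂ (EuclideanSpace ℂ (Fin n)),
      (∀ j : Fin n, (LinearMap.adjoint (Matrix.toEuclideanLin A) ∘ₗ Matrix.toEuclideanLin A) (e j) =
        ((singularValue A j ^ 2 : ℝ) : ℂ) • e j) ∧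
      0 ≤ ∑ i : Fin k, (inner ℂ (e (Fin.castLE hkn i))
        (Matrix.toEuclideanLin (Uᴴ * B) (e (Fin.castLE hkn i)))).re := by
  obtain ⟨e, g, hA, hB⟩ := LinearMap.exists_svd_nonneg_of_sum_singularValues_le
    finrank_euclideanSpace_fin hkn (Matrix.toEuclideanLin A) (Matrix.toEuclideanLin B)
    fun t _ => by
      have := h t
      rwa [kyFanNorm_eq_sum_fin, kyFanNorm_eq_sum_fin, map_add, map_smul] at this
  refine ⟨e, LinearMap.adjoint_comp_self_apply_of_svd
    (r := fun j : Fin n => singularValue A j) hA, hB.trans_eq ?_⟩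
  refine Finset.sum_congr rfl fun i _ => ?_
  rw [inner_toEuclideanLin_conjTranspose_mul,
    hU.apply_eq_of_svd (r := fun j : Fin n => singularValue A j) hA (hpos i i.2)]

theorem IsPolarDecomposition.hasRealOrthogonalEigenvectors {k : ℕ} (hkn : k ≤ n)
    (hU : IsPolarDecomposition A U) (hpos : ∀ i < k, 0 < singularValue A i)
    (h : ∀ t : ℝ, kyFanNorm k A ≤ kyFanNorm k (A + (t : ℂ) • B)) :
    HasRealOrthogonalEigenvectors k A U B := by
  obtain ⟨e, he, heB⟩ := hU.exists_eigenbasis_nonneg hkn hpos h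
  -- The hypothesis is invariant under `t ↦ -t`, so it holds for `-B` too.
  obtain ⟨e', he', heB'⟩ := hU.exists_eigenbasis_nonneg (B := -B) hkn hpos fun t => by
    simpa using h (-t)
  set Q := LinearMap.adjoint (Matrix.toEuclideanLin A) ∘ₗ Matrix.toEuclideanLin A
  obtain ⟨W, hW, hW0, hW1, hWQ⟩ := exists_unitary_path_of_eigenbases e e'
    (LinearMap.toContinuousLinearMap Q) he he'
  let w : ℝ → Fin k → EuclideanSpace ℂ (Fin n) := fun t i =>
    (W t : EuclideanSpace ℂ (Fin n) →L[ℂ] EuclideanSpace ℂ (Fin n)) (e (Fin.castLE hkn i))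
  let f : ℝ → ℝ := fun t =>
    ∑ i : Fin k, (inner ℂ (w t i) (Matrix.toEuclideanLin (Uᴴ * B) (w t i))).re
  have hw (i : Fin k) : Continuous fun t => w t i :=
    (continuous_subtype_val.comp hW).clm_apply continuous_const
  have hf : Continuous f :=
    continuous_finsetSum _ fun i _ => Complex.continuous_re.comp ((hw i).inner
      ((Matrix.toEuclideanLin (Uᴴ * B)).continuous_of_finiteDimensional.comp (hw i)))
  have hf0 : 0 ≤ f 0 := by simpa [f, w, hW0] using heB
  have hf1 : f 1 ≤ 0 := by simpa [f, w, hW1] using heB'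
  obtain ⟨t, -, ht⟩ := intermediate_value_Icc' zero_le_one hf.continuousOn ⟨hf1, hf0⟩
  refine ⟨w t, ?_, fun i => ?_, ht⟩
  · exact (e.orthonormal.comp _ (Fin.castLE_injective hkn)).comp_linearIsometryEquiv
      (Unitary.linearIsometryEquiv (W t))
  -- `W t` commutes with `Q`, so `w t i` stays in the eigenspace of `A*A` for `s_i²`.
  · refine (CFC.isPositive_toEuclideanLin_abs A).apply_eq_smul_of_comp_self (hpos i i.2) ?_
    rw [CFC.toEuclideanLin_abs_apply_abs]
    have h1 := DFunLike.congr_fun (hWQ t).eq (e (Fin.castLE hkn i))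
    have h2 : (W t : EuclideanSpace ℂ (Fin n) →L[ℂ] EuclideanSpace ℂ (Fin n))
      (Q (e (Fin.castLE hkn i))) = Q (w t i) := h1
    rw [he, map_smul] at h2
    exact h2.symm

end Polar

theorem theorem3p2 {n k : ℕ} (hk : 1 ≤ k) (hkn : k ≤ n)
    (A B U : Matrix (Fin n) (Fin n) ℂ) (hU : IsPolarDecomposition A U) :
    (HasRealOrthogonalEigenvectors k A U B →
      ∀ t : ℝ, kyFanNorm k A ≤ kyFanNorm k (A + (t : ℂ) • B)) ∧
    (0 < singularValue A (k - 1) →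
      (∀ t : ℝ, kyFanNorm k A ≤ kyFanNorm k (A + (t : ℂ) • B)) →
        HasRealOrthogonalEigenvectors k A U B) := by
  refine ⟨fun h => h.kyFanNorm_le hkn hU, fun hpos h =>
    hU.hasRealOrthogonalEigenvectors hkn (fun i hi => hpos.trans_le ?_) h⟩
  -- With indices from `0`, `k - 1` is the last of the `k` largest values.
  exact (Matrix.toEuclideanLin A).singularValues_antitone (by omega)
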